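/- \textbf{Definitions.} For integers $q\ge 0$ and $k\ge 1$, the Kneser graph $\mathrm{Kn}(q,k)$ is the graph whose vertices are the $k$-element subsets of $[q]=\{1,\dots,q\}$, two vertices being adjacent if and only if they are disjoint. The chromatic polynomial $\chi_G(n)$ of a finite graph $G$ is the polynomial in $n$ whose value at each $n\in\mathbb N=\{0,1,2,\dots\}$ is the number of proper colorings of the vertices of $G$ with $n$ colors. A \emph{numerical polynomial} is a polynomial $g\in\mathbb Q[x]$ with $g(q)\in\mathbb Z$ for every $q\in\mathbb Z$. Let $g$ be a numerical polynomial with $g(q)\ge 0$ for all sufficiently large $q$, let $S=\{q\in\mathbb N: g(q)\ge 0\}$, and let $e:S\to\mathbb N\cup\{-1,\infty\}$. A \emph{two-level polynomial of degree $g$ and depth $e$} is a sequence $(f_q)_{q\in S}$ of polynomials $f_q\in\mathbb Q[n]$, with $f_q$ of degree $g(q)$, such that, writing \[ f_q(n)=\sum_{r=0}^{\infty}c_r(q)\,n^{g(q)-r},\qquad c_r(q)=0 \text{ for } r>g(q), \] there are polynomials $\phi_0,\phi_1,\phi_2,\dots\in\mathbb Q[x]$ with $c_r(q)=\phi_r(q)$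 for every $q\in S$ and every integer $r$ with $0\le r\le e(q)$. For $q\in\mathbb N\setminus S$ one sets $f_q=0$ and $e(q)=-1$. The two-level polynomial has \emph{infinite depth} if $e(q)=\infty$ for all $q\in S$, that is, $c_r(q)=\phi_r(q)$ for all $q\in S$ and all $r\ge 0$ (including $r>g(q)$). \textbf{Theorem.} Fix $k\ge 1$. Then $f_q(n)=\chi_{\mathrm{Kn}(q,k)}(n)$, $q\in\mathbb N$, is a two-level polynomial of degree $\binom{q}{k}$ and infinite depth. Here the degree is the numerical polynomial $g(x)=\frac{x(x-1)\cdots(x-k+1)}{k!}$, for which $S=\mathbb N$. -/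

import Mathlib

namespace TwoLevel

open Polynomial

/-- A numerical polynomial: a rational polynomial taking integer values at all integers. -/
def IsNumerical (g : ℚ[X]) : Prop :=
  ∀ q : ℤ, ∃ m : ℤ, g.eval (q : ℚ) = (m : ℚ)

/-- The codegree `r` coefficient of `p`: if `p` has degree `d`, this is the coefficient of
the power `d - r` of the variable when `r ≤ d`, and `0` when `r > d`. -/
noncomputable def codegreeCoeff (p : ℚ[X]) (r : ℕ) : ℚ :=
  if r ≤ p.natDegree then p.coeff (p.natDegree - r) else 0

/-- `f` is a two-level polynomial of degree `g` and depth `e`.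
The index set is `S = {q ∈ ℕ : g(q) ≥ 0}`, and the sequence is extended to all of `ℕ` by
`f q = 0`, `e q = -1` for `q ∉ S`. The values of the depth function lie in `ℕ ∪ {-1, ∞}`,
which is `WithBot ℕ∞`, with `⊥` in the role of `-1` and `⊤` in the role of `∞`. -/
structure IsTwoLevelPolynomial (g : ℚ[X]) (e : ℕ → WithBot ℕ∞) (f : ℕ → ℚ[X]) : Prop where
  numerical : IsNumerical g
  eventually_nonneg : ∀ᶠ q : ℕ in Filter.atTop, 0 ≤ g.eval (q : ℚ)
  /-- For `q ∈ S`, the polynomial `f q` is nonzero of degree exactly `g(q)`. -/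
  degree_eq : ∀ q : ℕ, 0 ≤ g.eval (q : ℚ) →
    f q ≠ 0 ∧ ((f q).natDegree : ℚ) = g.eval (q : ℚ)
  /-- Up to the depth, the codegree `r` coefficients agree with one polynomial in `q`. -/
  coeff_eq : ∃ φ : ℕ → ℚ[X], ∀ q : ℕ, 0 ≤ g.eval (q : ℚ) →
    ∀ r : ℕ, ((r : ℕ∞) : WithBot ℕ∞) ≤ e q → codegreeCoeff (f q) r = (φ r).eval (q : ℚ)
  eq_zero_of_neg : ∀ q : ℕ, g.eval (q : ℚ) < 0 → f q = 0
  depth_of_neg : ∀ q : ℕ, g.eval (q : ℚ) < 0 → e q = ⊥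

/-- The polynomial `x (x - 1) ⋯ (x - k + 1) / k!`. -/
noncomputable def binomialPolynomial (k : ℕ) : ℚ[X] :=
  C ((k.factorial : ℚ)⁻¹) * descPochhammer ℚ k

theorem binomialPolynomial_eval (k q : ℕ) :
    (binomialPolynomial k).eval (q : ℚ) = (q.choose k : ℚ) := by
  have hk : (k.factorial : ℚ) ≠ 0 := by exact_mod_cast k.factorial_ne_zero
  rw [binomialPolynomial, eval_mul, eval_C, descPochhammer_eval_eq_descFactorial,
    Nat.descFactorial_eq_factorial_mul_choose, Nat.cast_mul, inv_mul_cancel_left₀ hk]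

/-- The Kneser graph on the `k`-subsets of a `q`-element set, adjacency being disjointness.
(The requirement that adjacent vertices be distinct is automatic for `k ≥ 1`.) -/
def kneserGraph (q k : ℕ) : SimpleGraph {s : Finset (Fin q) // s.card = k} where
  Adj s t := s ≠ t ∧ Disjoint s.1 t.1
  symm := ⟨fun _ _ h => ⟨h.1.symm, h.2.symm⟩⟩
  loopless := ⟨fun _ h => h.1 rfl⟩

theorem kneserGraph_adj {q k : ℕ} (hk : 1 ≤ k) (s t : {s : Finset (Fin q) // s.card = k}) :
    (kneserGraph q k).Adj s t ↔ Disjoint s.1 t.1 := by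
  refine ⟨fun h => h.2, fun h => ⟨?_, h⟩⟩
  rintro rfl
  have h0 : s.1 = ∅ := by simpa using h
  have h1 := s.2
  rw [h0, Finset.card_empty] at h1
  omega

/-- `p` is the chromatic polynomial of `G`: for every natural number `n`, its value at `n` is
the number of proper colorings of the vertices of `G` with `n` colors. -/
def IsChromaticPolynomial {V : Type*} (G : SimpleGraph V) (p : ℚ[X]) : Prop :=
  ∀ n : ℕ, p.eval (n : ℚ) = (Nat.card (G.Coloring (Fin n)) : ℚ)

/-- A graph has at most one chromatic polynomial. -/
theorem IsChromaticPolynomial.unique {V : Type*} {G : SimpleGraph V} {p p' : ℚ[X]}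
    (h : IsChromaticPolynomial G p) (h' : IsChromaticPolynomial G p') : p = p' :=
  Polynomial.eq_of_infinite_eval_eq p p'
    ((Set.infinite_range_of_injective (Nat.cast_injective (R := ℚ))).mono
      (by rintro _ ⟨n, rfl⟩; exact (h n).trans (h' n).symm))

end TwoLevel

/-!
By Whitney's subgraph expansion, the coefficient of codegree `r` in the chromatic polynomial of `G`
is the sum of `(-1) ^ |A|` over the sets `A` of edges of rank `r`, where the rank of `A` is the
number of vertices minus the number of components. A graph of rank `r` has at most `2 * r`
non-isolated vertices, so when the vertices are `k`-subsets of `Fin q`, at most `2 * r * k` points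
of `Fin q` are involved. The contribution of the `A` that involve exactly a given set of `j` points
depends on `j` only, since disjointness of `k`-sets is preserved and reflected by injections.
Summing over the `q.choose j` sets of `j` points, for all `j ≤ 2 * r * k`, the coefficient becomes a
fixed combination of the polynomials `q.choose j`.
-/

namespace TwoLevel

open Polynomial Finset

section Rank

variable {V W : Type*}

/-- The rank of a graph, in the sense of its graphic matroid: the number of vertices minus the
number of connected components. Meaningful for finite graphs only. -/
noncomputable def rank (H : SimpleGraph V) : ℕ :=
  Nat.card V - Nat.card H.ConnectedComponent

theorem card_connectedComponent_le [Finite V] (H : SimpleGraph V) :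
    Nat.card H.ConnectedComponent ≤ Nat.card V :=
  Nat.card_le_card_of_surjective H.connectedComponentMk Quot.mk_surjective

theorem card_connectedComponent_add_rank [Finite V] (H : SimpleGraph V) :
    Nat.card H.ConnectedComponent + rank H = Nat.card V :=
  Nat.add_sub_of_le (card_connectedComponent_le H)

theorem eq_of_reachable {X : Type*} {H : SimpleGraph V} {c : V → X}
    (hc : ∀ u v, H.Adj u v → c u = c v) {u v : V} (h : H.Reachable u v) : c u = c v := by
  obtain ⟨p⟩ := h
  induction p with
  | nil => rfl
  | cons huv _ ih => exact (hc _ _ huv).trans ih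

theorem rank_bot : rank (⊥ : SimpleGraph V) = 0 := by
  have hbij : Function.Bijective (⊥ : SimpleGraph V).connectedComponentMk :=
    ⟨fun _ _ h => SimpleGraph.reachable_bot.1 (SimpleGraph.ConnectedComponent.exact h),
      Quot.mk_surjective⟩
  rw [rank, Nat.card_eq_of_bijective _ hbij, Nat.sub_self]

theorem rank_congr {G : SimpleGraph V} {H : SimpleGraph W} (φ : G ≃g H) : rank G = rank H := by
  rw [rank, rank, Nat.card_congr φ.toEquiv, Nat.card_congr φ.connectedComponentEquiv]

/-- The connected components of a disjoint sum of graphs are those of the two summands. -/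
def connectedComponentSumEquiv (G : SimpleGraph V) (H : SimpleGraph W) :
    (G ⊕g H).ConnectedComponent ≃ G.ConnectedComponent ⊕ H.ConnectedComponent where
  toFun := Quot.lift (Sum.map G.connectedComponentMk H.connectedComponentMk) fun _ _ =>
    eq_of_reachable <| by
      rintro (u | u) (v | v) h
      · exact congrArg Sum.inl
          (SimpleGraph.ConnectedComponent.connectedComponentMk_eq_of_adj h)
      · exact absurd h Bool.false_ne_true
      · exact absurd h Bool.false_ne_true
      · exact congrArg Sum.inr
          (SimpleGraph.ConnectedComponent.connectedComponentMk_eq_of_adj h)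
  invFun := Sum.elim (.map SimpleGraph.Embedding.sumInl.toHom)
    (.map SimpleGraph.Embedding.sumInr.toHom)
  left_inv C := by
    induction C using SimpleGraph.ConnectedComponent.ind with | h v => ?_
    rcases v with v | v <;> rfl
  right_inv C := by
    rcases C with C | C <;> induction C using SimpleGraph.ConnectedComponent.ind <;> rfl

theorem rank_sum [Finite V] [Finite W] (G : SimpleGraph V) (H : SimpleGraph W) :
    rank (G ⊕g H) = rank G + rank H := by
  have hcard := Nat.card_congr (connectedComponentSumEquiv G H)
  rw [Nat.card_sum] at hcard
  have hsum := card_connectedComponent_add_rank (G ⊕g H)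
  rw [Nat.card_sum] at hsum
  have hG := card_connectedComponent_add_rank G
  have hH := card_connectedComponent_add_rank H
  omega

open Classical in
/-- The image of a graph under an embedding is the graph together with isolated vertices, one for
each vertex outside the range. -/
noncomputable def sumBotIsoMap (f : V ↪ W) (H : SimpleGraph V) :
    H ⊕g (⊥ : SimpleGraph ↥(Set.range f)ᶜ) ≃g H.map f where
  toEquiv := ((Equiv.ofInjective f f.injective).sumCongr (Equiv.refl _)).trans
    (Equiv.Set.sumCompl (Set.range f))
  map_rel_iff' := by
    have not_adj (x : ↥(Set.range f)ᶜ) (y : W) : ¬ (H.map f).Adj x y := fun h =>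
      x.2 (Set.image_subset_range _ _ (SimpleGraph.support_map f H ▸ h.mem_support_left))
    rintro (u | u) (v | v)
    · exact SimpleGraph.map_adj_apply
    · exact iff_of_false (fun h => not_adj v _ h.symm) Bool.false_ne_true
    · exact iff_of_false (not_adj u _) Bool.false_ne_true
    · exact iff_of_false (not_adj u _) id

theorem rank_map [Finite W] (f : V ↪ W) (H : SimpleGraph V) : rank (H.map f) = rank H := by
  have : Finite V := Finite.of_injective f f.injective
  rw [← rank_congr (sumBotIsoMap f H), rank_sum, rank_bot, add_zero]

/-- A component that meets the support has at least two vertices in it. -/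
theorem ncard_support_le_two_mul_rank [Finite V] (H : SimpleGraph V) :
    H.support.ncard ≤ 2 * rank H := by
  classical
  have := Fintype.ofFinite V
  let mk := H.connectedComponentMk
  let S := H.support.toFinset
  have two_mul_card_image : 2 * #(S.image mk) ≤ #S := by
    refine mul_card_image_le_card S 2 (forall_mem_image.2 fun v hv => ?_)
    obtain ⟨w, hvw⟩ := H.mem_support.1 (Set.mem_toFinset.1 hv)
    have hw : w ∈ S := Set.mem_toFinset.2 hvw.mem_support_right
    have hmk : mk w = mk v :=
      (SimpleGraph.ConnectedComponent.connectedComponentMk_eq_of_adj hvw).symm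
    exact one_lt_card.2 ⟨v, by simp [hv], w, by simp [hw, hmk], hvw.ne⟩
  have card_components : Nat.card H.ConnectedComponent ≤ #(S.image mk) + #Sᶜ :=
    calc Nat.card H.ConnectedComponent = #(univ.image mk) := by
          rw [image_univ_of_surjective (f := mk) Quot.mk_surjective, card_univ,
            Nat.card_eq_fintype_card]
      _ = #(S.image mk ∪ Sᶜ.image mk) := by rw [← image_union, union_compl]
      _ ≤ #(S.image mk) + #Sᶜ := (card_union_le _ _).trans (by gcongr; exact card_image_le)
  have hS : H.support.ncard = #S := Set.ncard_eq_toFinset_card' _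
  have hrank := card_connectedComponent_add_rank H
  rw [Nat.card_eq_fintype_card (α := V), ← card_add_card_compl S] at hrank
  omega

theorem rank_eq_zero_iff [Finite V] {H : SimpleGraph V} : rank H = 0 ↔ H = ⊥ := by
  refine ⟨fun h => ?_, fun h => h ▸ rank_bot⟩
  have hle := ncard_support_le_two_mul_rank H
  rw [h, mul_zero, Nat.le_zero, Set.ncard_eq_zero] at hle
  exact H.support_eq_bot_iff.1 hle

end Rank

section Coloring

variable {V κ : Type*}

theorem card_coloring (G : SimpleGraph V) :
    Nat.card (G.Coloring κ) = Nat.card {c : V → κ // G ≤ (⊤ : SimpleGraph κ).comap c} :=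
  Nat.card_congr
    { toFun c := ⟨c, c.le_comap⟩
      invFun c := ⟨c.1, fun h => c.2 h⟩ }

theorem disjoint_comap_top_iff {H : SimpleGraph V} {c : V → κ} :
    Disjoint H ((⊤ : SimpleGraph κ).comap c) ↔ ∀ u v, H.Adj u v → c u = c v := by
  rw [disjoint_iff_inf_le]
  exact forall₂_congr fun u v => by simp

theorem card_disjoint_comap_top [Finite V] (H : SimpleGraph V) :
    Nat.card {c : V → κ // Disjoint H ((⊤ : SimpleGraph κ).comap c)} =
      Nat.card κ ^ Nat.card H.ConnectedComponent := by
  rw [← Nat.card_fun]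
  exact Nat.card_congr
    { toFun c := Quot.lift c.1 fun _ _ => eq_of_reachable (disjoint_comap_top_iff.1 c.2)
      invFun d := ⟨d ∘ H.connectedComponentMk, disjoint_comap_top_iff.2 fun _ _ h =>
        congrArg d (SimpleGraph.ConnectedComponent.connectedComponentMk_eq_of_adj h)⟩
      left_inv _ := rfl
      right_inv d := funext (SimpleGraph.ConnectedComponent.ind fun _ => rfl) }

end Coloring

section ChromaticPolynomial

variable {V : Type*} [Finite V]

/-- The finite set of spanning subgraphs of `G`, that is, of sets of edges of `G`. -/
noncomputable def subgraphs (G : SimpleGraph V) : Finset (SimpleGraph V) :=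
  (Set.toFinite (Set.Iic G)).toFinset

theorem mem_subgraphs {G H : SimpleGraph V} : H ∈ subgraphs G ↔ H ≤ G :=
  Set.Finite.mem_toFinset _

/-- The chromatic polynomial of `G`, given by Whitney's subgraph expansion. -/
noncomputable def chromaticPolynomial (G : SimpleGraph V) : ℚ[X] :=
  ∑ H ∈ subgraphs G, C ((-1) ^ H.edgeSet.ncard) * X ^ Nat.card H.ConnectedComponent

/-- The Whitney number of the first kind of the graphic matroid of `G`: the sum of `(-1) ^ |A|`
over the sets `A` of edges of rank `r`. -/
noncomputable def whitneyNumber (G : SimpleGraph V) (r : ℕ) : ℚ :=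
  ∑ H ∈ subgraphs G with rank H = r, (-1) ^ H.edgeSet.ncard

theorem sum_subgraphs_neg_one_pow (G : SimpleGraph V) [Decidable (G = ⊥)] :
    ∑ H ∈ subgraphs G, (-1 : ℚ) ^ H.edgeSet.ncard = if G = ⊥ then 1 else 0 := by
  classical
  have := Fintype.ofFinite V
  have subset_edgeSet {A : Finset (Sym2 V)} (hA : A ∈ G.edgeFinset.powerset) : ↑A ⊆ G.edgeSet :=
    Set.subset_toFinset.1 (mem_powerset.1 hA)
  calc ∑ H ∈ subgraphs G, (-1 : ℚ) ^ H.edgeSet.ncard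
      = ∑ A ∈ G.edgeFinset.powerset, (-1 : ℚ) ^ #A := by
        refine sum_nbij' (fun H => H.edgeFinset) (fun A => SimpleGraph.fromEdgeSet A)
          (fun H hH => mem_powerset.2 (SimpleGraph.edgeFinset_mono (mem_subgraphs.1 hH)))
          (fun A hA => mem_subgraphs.2 ?_) (fun H _ => ?_) (fun A hA => ?_) fun H _ => ?_
        · rw [SimpleGraph.fromEdgeSet_le]
          exact Set.sdiff_subset.trans (subset_edgeSet hA)
        · rw [SimpleGraph.coe_edgeFinset, SimpleGraph.fromEdgeSet_edgeSet]
        · rw [← Finset.coe_inj, SimpleGraph.coe_edgeFinset, SimpleGraph.edgeSet_fromEdgeSet,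
            sdiff_eq_left, ← Set.subset_compl_iff_disjoint_right]
          exact (subset_edgeSet hA).trans G.edgeSet_subset_compl_diagSet
        · rw [Set.ncard_eq_toFinset_card', SimpleGraph.edgeFinset]
    _ = if G.edgeFinset = ∅ then 1 else 0 := by
        exact_mod_cast sum_powerset_neg_one_pow_card (x := G.edgeFinset)
    _ = if G = ⊥ then 1 else 0 := if_congr SimpleGraph.edgeFinset_eq_empty rfl rfl

/-- The monochromatic edges of `G` under a coloring `c` form the graph `G \ ⊤.comap c`, and the
alternating sum over its subgraphs detects whether it is empty, that is, whether `c` is proper. -/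
theorem isChromaticPolynomial_chromaticPolynomial (G : SimpleGraph V) :
    IsChromaticPolynomial G (chromaticPolynomial G) := by
  classical
  have := Fintype.ofFinite V
  intro n
  let K (c : V → Fin n) : SimpleGraph V := (⊤ : SimpleGraph (Fin n)).comap c
  have hsub (c : V → Fin n) : {H ∈ subgraphs G | Disjoint H (K c)} = subgraphs (G \ K c) := by
    ext H
    rw [mem_filter, mem_subgraphs, mem_subgraphs, le_sdiff]
  symm
  calc (Nat.card (G.Coloring (Fin n)) : ℚ)
      = ∑ c : V → Fin n, if G ≤ K c then 1 else 0 := by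
        rw [card_coloring, Nat.card_eq_fintype_card, Fintype.card_subtype, natCast_card_filter]
    _ = ∑ c : V → Fin n, ∑ H ∈ subgraphs G,
          if Disjoint H (K c) then (-1) ^ H.edgeSet.ncard else 0 := by
        refine sum_congr rfl fun c _ => ?_
        rw [← sum_filter, hsub, sum_subgraphs_neg_one_pow]
        exact if_congr sdiff_eq_bot_iff.symm rfl rfl
    _ = ∑ H ∈ subgraphs G, (-1) ^ H.edgeSet.ncard * (n : ℚ) ^ Nat.card H.ConnectedComponent := by
        rw [sum_comm]
        refine sum_congr rfl fun H _ => ?_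
        rw [← sum_filter, sum_const, ← Fintype.card_subtype, ← Nat.card_eq_fintype_card,
          card_disjoint_comap_top, Nat.card_fin, nsmul_eq_mul, Nat.cast_pow, mul_comm]
    _ = (chromaticPolynomial G).eval (n : ℚ) := by
        simp only [chromaticPolynomial, eval_finsetSum, eval_mul, eval_C, eval_pow, eval_X]

theorem coeff_chromaticPolynomial (G : SimpleGraph V) {m r : ℕ} (h : m + r = Nat.card V) :
    (chromaticPolynomial G).coeff m = whitneyNumber G r := by
  rw [chromaticPolynomial, finsetSum_coeff, whitneyNumber, sum_filter]
  refine sum_congr rfl fun H _ => ?_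
  rw [coeff_C_mul_X_pow]
  have := card_connectedComponent_add_rank H
  exact if_congr (by omega) rfl rfl

theorem whitneyNumber_zero (G : SimpleGraph V) : whitneyNumber G 0 = 1 := by
  have : {H ∈ subgraphs G | rank H = 0} = {⊥} := by
    ext H
    rw [mem_filter, mem_subgraphs, rank_eq_zero_iff, mem_singleton]
    exact and_iff_right_of_imp fun h => h ▸ bot_le
  rw [whitneyNumber, this, sum_singleton, SimpleGraph.edgeSet_bot, Set.ncard_empty, pow_zero]

theorem natDegree_chromaticPolynomial_le (G : SimpleGraph V) :
    (chromaticPolynomial G).natDegree ≤ Nat.card V :=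
  natDegree_sum_le_of_forall_le _ _ fun H _ =>
    (natDegree_C_mul_X_pow_le _ _).trans (card_connectedComponent_le H)

theorem coeff_card_chromaticPolynomial (G : SimpleGraph V) :
    (chromaticPolynomial G).coeff (Nat.card V) = 1 := by
  rw [coeff_chromaticPolynomial G (add_zero _), whitneyNumber_zero]

theorem monic_chromaticPolynomial (G : SimpleGraph V) : (chromaticPolynomial G).Monic :=
  monic_of_natDegree_le_of_coeff_eq_one _ (natDegree_chromaticPolynomial_le G)
    (coeff_card_chromaticPolynomial G)

theorem natDegree_chromaticPolynomial (G : SimpleGraph V) :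
    (chromaticPolynomial G).natDegree = Nat.card V :=
  natDegree_eq_of_le_of_coeff_ne_zero (natDegree_chromaticPolynomial_le G)
    (coeff_card_chromaticPolynomial G ▸ one_ne_zero)

theorem whitneyNumber_eq_zero (G : SimpleGraph V) {r : ℕ} (h : Nat.card V < r) :
    whitneyNumber G r = 0 := by
  rw [whitneyNumber, filter_false_of_mem, sum_empty]
  rintro H - rfl
  exact (Nat.sub_le _ _).not_gt h

theorem codegreeCoeff_chromaticPolynomial (G : SimpleGraph V) (r : ℕ) :
    codegreeCoeff (chromaticPolynomial G) r = whitneyNumber G r := by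
  rw [codegreeCoeff, natDegree_chromaticPolynomial]
  split_ifs with h
  · exact coeff_chromaticPolynomial G (Nat.sub_add_cancel h)
  · exact (whitneyNumber_eq_zero G (not_le.1 h)).symm

end ChromaticPolynomial

section KSubset

variable {α β : Type*} {k : ℕ}

/-- The `k`-element subsets of `α`. -/
abbrev KSubset (α : Type*) (k : ℕ) : Type _ := {s : Finset α // #s = k}

/-- The map on `k`-element subsets induced by an injection. -/
def mapKSubset (k : ℕ) (e : α ↪ β) : KSubset α k ↪ KSubset β k :=
  (mapEmbedding e).toEmbedding.subtypeMap fun _ hs => (card_map e).trans hs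

/-- The union of the non-isolated vertices of a graph whose vertices are `k`-element sets. -/
noncomputable def groundSet [Finite α] (H : SimpleGraph (KSubset α k)) : Finset α :=
  (Set.toFinite {x | ∃ s ∈ H.support, x ∈ s.1}).toFinset

theorem mem_groundSet [Finite α] {H : SimpleGraph (KSubset α k)} {x : α} :
    x ∈ groundSet H ↔ ∃ s ∈ H.support, x ∈ s.1 :=
  Set.Finite.mem_toFinset _

theorem card_groundSet_le [Finite α] (H : SimpleGraph (KSubset α k)) :
    #(groundSet H) ≤ H.support.ncard * k := by
  classical
  have hfin : H.support.Finite := Set.toFinite _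
  have hunion : groundSet H = hfin.toFinset.biUnion Subtype.val := by
    ext x
    rw [mem_groundSet, mem_biUnion]
    simp only [hfin.mem_toFinset]
  rw [hunion, Set.ncard_eq_toFinset_card _ hfin]
  exact card_biUnion_le_card_mul _ _ _ fun s _ => s.2.le

theorem groundSet_map [Finite α] [Finite β] (e : α ↪ β) (H : SimpleGraph (KSubset α k)) :
    groundSet (H.map (mapKSubset k e)) = (groundSet H).map e := by
  ext x
  rw [mem_groundSet, SimpleGraph.support_map, Set.exists_mem_image, mem_map]
  constructor
  · rintro ⟨s, hs, hx⟩
    obtain ⟨y, hy, rfl⟩ := mem_map.1 hx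
    exact ⟨y, mem_groundSet.2 ⟨s, hs, hy⟩, rfl⟩
  · rintro ⟨y, hy, rfl⟩
    obtain ⟨s, hs, hys⟩ := mem_groundSet.1 hy
    exact ⟨s, hs, mem_map_of_mem e hys⟩

theorem mem_range_mapKSubset {e : α ↪ β} {s : KSubset β k} (h : ↑s.1 ⊆ Set.range e) :
    s ∈ Set.range (mapKSubset k e) := by
  classical
  obtain ⟨t, ht⟩ : ∃ t : Finset α, t.map e = s.1 :=
    ⟨s.1.preimage e e.injective.injOn, by rw [map_eq_image, image_preimage, filter_true_of_mem h]⟩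
  exact ⟨⟨t, by rw [← card_map e, ht, s.2]⟩, Subtype.ext ht⟩

theorem map_comap_of_support_subset {V W : Type*} (f : V ↪ W) {H : SimpleGraph W}
    (h : H.support ⊆ Set.range f) : (H.comap f).map f = H := by
  refine le_antisymm (SimpleGraph.map_comap_le f H) fun u v huv => ?_
  obtain ⟨u, rfl⟩ := h huv.mem_support_left
  obtain ⟨v, rfl⟩ := h huv.mem_support_right
  exact SimpleGraph.map_adj_apply.2 huv

theorem map_comap_mapKSubset [Finite β] {e : α ↪ β} {H : SimpleGraph (KSubset β k)}
    (h : ↑(groundSet H) ⊆ Set.range e) :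
    (H.comap (mapKSubset k e)).map (mapKSubset k e) = H :=
  map_comap_of_support_subset _ fun s hs =>
    mem_range_mapKSubset fun _ hx => h (mem_coe.2 (mem_groundSet.2 ⟨s, hs, hx⟩))

end KSubset

section WhitneyNumberOn

variable {α β : Type*} [DecidableEq α] [DecidableEq β] {k : ℕ}

/-- The contribution to `whitneyNumber G r` of the subgraphs with ground set `A`. -/
noncomputable def whitneyNumberOn [Finite α] (G : SimpleGraph (KSubset α k)) (r : ℕ)
    (A : Finset α) : ℚ :=
  ∑ H ∈ subgraphs G with rank H = r ∧ groundSet H = A, (-1) ^ H.edgeSet.ncard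

theorem sum_whitneyNumberOn [Fintype α] (G : SimpleGraph (KSubset α k)) (r : ℕ) :
    ∑ A : Finset α, whitneyNumberOn G r A = whitneyNumber G r := by
  simp only [whitneyNumberOn, whitneyNumber, ← filter_filter]
  exact sum_fiberwise _ _ _

theorem whitneyNumberOn_eq_zero [Finite α] (G : SimpleGraph (KSubset α k)) {r : ℕ} {A : Finset α}
    (h : 2 * r * k < #A) : whitneyNumberOn G r A = 0 := by
  rw [whitneyNumberOn, filter_false_of_mem, sum_empty]
  rintro H - ⟨rfl, rfl⟩
  exact h.not_ge ((card_groundSet_le H).trans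
    (Nat.mul_le_mul_right k (ncard_support_le_two_mul_rank H)))

theorem whitneyNumberOn_map [Finite α] [Finite β] (e : α ↪ β) (G : SimpleGraph (KSubset β k))
    (r : ℕ) (A : Finset α) :
    whitneyNumberOn G r (A.map e) = whitneyNumberOn (G.comap (mapKSubset k e)) r A := by
  let f := mapKSubset k e
  have hmem (H : SimpleGraph (KSubset α k)) :
      H.map f ∈ {H ∈ subgraphs G | rank H = r ∧ groundSet H = A.map e} ↔
        H ∈ {H ∈ subgraphs (G.comap f) | rank H = r ∧ groundSet H = A} := by
    simp only [mem_filter, mem_subgraphs, SimpleGraph.map_le_iff_le_comap, rank_map, f,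
      groundSet_map, map_inj]
  refine (sum_nbij (SimpleGraph.map f) (fun H hH => (hmem H).2 hH)
    (SimpleGraph.map_injective f).injOn (fun H hH => ?_) fun H _ => ?_).symm
  · have hmap : (H.comap f).map f = H := map_comap_mapKSubset <| by
      rw [(mem_filter.1 hH).2.2, coe_map]
      exact Set.image_subset_range _ _
    exact ⟨H.comap f, (hmem _).1 (hmap.symm ▸ hH), hmap⟩
  · rw [SimpleGraph.edgeSet_map, Set.ncard_image_of_injective _ f.sym2Map.injective]

end WhitneyNumberOn

section InjectionInvariant

variable {k : ℕ}

/-- A family of graphs on the `k`-element subsets of `Fin q`, one for each `q`, is invariant under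
injections if adjacency of two `k`-sets does not change when both are carried along an injection
`Fin j ↪ Fin q`. The Kneser graphs and the Johnson graphs are examples. -/
def IsInjectionInvariant (G : ∀ q : ℕ, SimpleGraph (KSubset (Fin q) k)) : Prop :=
  ∀ ⦃j q : ℕ⦄ (e : Fin j ↪ Fin q), (G q).comap (mapKSubset k e) = G j

theorem isInjectionInvariant_kneserGraph (k : ℕ) :
    IsInjectionInvariant fun q => kneserGraph q k := by
  intro j q e
  ext s t
  exact and_congr (mapKSubset k e).injective.ne_iff (disjoint_map e)

theorem IsInjectionInvariant.whitneyNumberOn_eq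
    {G : ∀ q : ℕ, SimpleGraph (KSubset (Fin q) k)} (hG : IsInjectionInvariant G) (q r : ℕ)
    (A : Finset (Fin q)) : whitneyNumberOn (G q) r A = whitneyNumberOn (G #A) r univ := by
  have hA : univ.map (A.orderEmbOfFin rfl).toEmbedding = A := map_orderEmbOfFin_univ A rfl
  rw [← hG (A.orderEmbOfFin rfl).toEmbedding, ← whitneyNumberOn_map, hA]

theorem sum_apply_card_eq_sum_range {M : Type*} [Semiring M] (F : ℕ → M) {d : ℕ}
    (hF : ∀ j, d < j → F j = 0) (q : ℕ) :
    ∑ A : Finset (Fin q), F #A = ∑ j ∈ range (d + 1), F j * (q.choose j : M) := by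
  rw [← powerset_univ, sum_powerset_apply_card, card_univ, Fintype.card_fin]
  refine sum_congr_of_eq_on_inter (fun j _ hj => ?_) (fun j _ hj => ?_) fun j _ _ => ?_
  · rw [hF j (by simpa using hj), smul_zero]
  · rw [Nat.choose_eq_zero_of_lt (by simpa using hj), Nat.cast_zero, mul_zero]
  · rw [nsmul_eq_mul, Nat.cast_comm]

theorem IsInjectionInvariant.exists_polynomial_whitneyNumber
    {G : ∀ q : ℕ, SimpleGraph (KSubset (Fin q) k)} (hG : IsInjectionInvariant G) (r : ℕ) :
    ∃ φ : ℚ[X], ∀ q : ℕ, whitneyNumber (G q) r = φ.eval (q : ℚ) := by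
  let w (j : ℕ) : ℚ := whitneyNumberOn (G j) r univ
  have hw (j : ℕ) (hj : 2 * r * k < j) : w j = 0 :=
    whitneyNumberOn_eq_zero _ (by rwa [card_univ, Fintype.card_fin])
  refine ⟨∑ j ∈ range (2 * r * k + 1), C (w j) * binomialPolynomial j, fun q => ?_⟩
  calc whitneyNumber (G q) r
      = ∑ A : Finset (Fin q), w #A := by
        rw [← sum_whitneyNumberOn]
        exact sum_congr rfl fun A _ => hG.whitneyNumberOn_eq q r A
    _ = ∑ j ∈ range (2 * r * k + 1), w j * (q.choose j : ℚ) := sum_apply_card_eq_sum_range w hw q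
    _ = _ := by simp only [eval_finsetSum, eval_mul, eval_C, binomialPolynomial_eval]

end InjectionInvariant

theorem binomialPolynomial_eval_nonneg (k q : ℕ) : 0 ≤ (binomialPolynomial k).eval (q : ℚ) := by
  rw [binomialPolynomial_eval]
  exact Nat.cast_nonneg _

theorem isNumerical_binomialPolynomial (k : ℕ) : IsNumerical (binomialPolynomial k) := by
  intro q
  refine ⟨Ring.choose q k, ?_⟩
  have hk : (k.factorial : ℚ) ≠ 0 := by exact_mod_cast k.factorial_ne_zero
  have h := Ring.descPochhammer_eq_factorial_smul_choose q k
  rw [← eval_eq_smeval, nsmul_eq_mul] at h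
  rw [binomialPolynomial, eval_mul, eval_C, ← descPochhammer_map (Int.castRingHom ℚ) k,
    ← eq_intCast (Int.castRingHom ℚ) q, eval_map_apply, h, map_mul, map_natCast,
    inv_mul_cancel_left₀ hk, eq_intCast]

end TwoLevel

open TwoLevel in
theorem mainTheorem2_general {k : ℕ} (G : ∀ q : ℕ, SimpleGraph (KSubset (Fin q) k))
    (hG : IsInjectionInvariant G) :
    ∃ f : ℕ → Polynomial ℚ, (∀ q : ℕ, IsChromaticPolynomial (G q) (f q)) ∧
      IsTwoLevelPolynomial (binomialPolynomial k) (fun _ => ⊤) f := by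
  choose φ hφ using hG.exists_polynomial_whitneyNumber
  refine ⟨fun q => chromaticPolynomial (G q),
    fun q => isChromaticPolynomial_chromaticPolynomial (G q), ?_⟩
  have hnonneg := binomialPolynomial_eval_nonneg k
  exact
    { numerical := isNumerical_binomialPolynomial k
      eventually_nonneg := Filter.Eventually.of_forall hnonneg
      degree_eq := fun q _ => by
        refine ⟨(monic_chromaticPolynomial (G q)).ne_zero, ?_⟩
        rw [natDegree_chromaticPolynomial, binomialPolynomial_eval, Nat.card_eq_fintype_card,
          Fintype.card_finset_len, Fintype.card_fin]
      coeff_eq := ⟨φ, fun q _ r _ => by rw [codegreeCoeff_chromaticPolynomial, hφ]⟩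
      eq_zero_of_neg := fun q h => absurd h (hnonneg q).not_gt
      depth_of_neg := fun q h => absurd h (hnonneg q).not_gt }

theorem mainTheorem2 (k : ℕ) (hk : 1 ≤ k) :
    ∃ f : ℕ → Polynomial ℚ,
      (∀ q : ℕ, TwoLevel.IsChromaticPolynomial (TwoLevel.kneserGraph q k) (f q)) ∧
      TwoLevel.IsTwoLevelPolynomial (TwoLevel.binomialPolynomial k) (fun _ => ⊤) f :=
  mainTheorem2_general _ (TwoLevel.isInjectionInvariant_kneserGraph k)
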